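/- All graphs are finite, without loops and multiple edges. For graphs $G,H$, the complex $Hom(G,H)$ is the cell complex $$Hom(G,H)=\bigcup_{\eta}\ \prod_{v\in V(G)}\Delta^{\eta(v)}\ \subset\ \prod_{v\in V(G)}\Delta^{V(H)},$$ where $\Delta^{S}$ denotes the simplex spanned by the vertex set $S$, and $\eta$ runs over all functions $\eta:V(G)\to 2^{V(H)}\setminus\{\emptyset\}$ such that, for every edge $uv$ of $G$, each vertex in $\eta(u)$ is adjacent in $H$ to each vertex in $\eta(v)$. A graph homomorphism $f:G\to G'$ induces the continuous map $\widehat f:Hom(G',H)\to Hom(G,H)$, $(x_w)_{w\in V(G')}\mapsto (x_{f(v)})_{v\in V(G)}$, which maps the cell indexed by $\eta$ to the cell indexed by $\eta\circ f$. **Theorem 4.1.** Let $H$ be a graph and $r\ge 1$. Suppose that $\alpha:K_2\to C_{2r+1}$ is an inclusion map (an embedding of $K_2$ as an edge of the cycle $C_{2r+1}$), that $\beta:K_2\to K_2$ is the nontrivial automorphism of $K_2$, and let $$\widehat\alpha:Hom(C_{2r+1},H)\to Hom(K_2,H),\qquad \widehat\beta:Hom(K_2,H)\to Hom(K_2,H)$$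 be the associated maps of graph complexes. Then $\widehat\alpha$ and $\widehat\beta\circ\widehat\alpha$ are homotopic. -/

import Mathlib

/-- A function `η` from the vertices of `G` to the nonempty sets of vertices of `H` indexes a cell
of `Hom(G, H)` if, for every edge `uv` of `G`, every vertex in `η u` is adjacent in `H` to every
vertex in `η v` (in particular `η u` and `η v` are disjoint). -/
def IsHomCell {V W : Type*} (G : SimpleGraph V) (H : SimpleGraph W) (η : V → Set W) : Prop :=
  (∀ v, (η v).Nonempty) ∧ ∀ u v, G.Adj u v → ∀ a ∈ η u, ∀ b ∈ η v, H.Adj a b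

/-- The geometric simplex `Δ^S` spanned by `S ⊆ W`, as a face of the standard simplex on `W`. -/
def simplexOn {W : Type*} [Fintype W] (S : Set W) : Set (W → ℝ) :=
  {p | p ∈ stdSimplex ℝ W ∧ ∀ w, p w ≠ 0 → w ∈ S}

/-- The closed cell `c_η = ∏_v Δ^{η v}`. -/
def homCell {V W : Type*} [Fintype W] (η : V → Set W) : Set (V → W → ℝ) :=
  {x | ∀ v, x v ∈ simplexOn (η v)}

/-- The complex `Hom(G, H)` of the finite graphs `G` and `H`: the union of its cells inside the
product, over the vertices of `G`, of copies of the standard simplex on the vertices of `H`.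
As a space it carries the subspace topology. -/
def homComplex {V W : Type*} [Fintype W] (G : SimpleGraph V) (H : SimpleGraph W) :
    Set (V → W → ℝ) :=
  {x | ∃ η : V → Set W, IsHomCell G H η ∧ x ∈ homCell η}

theorem IsHomCell.comp_hom {V V' W : Type*} {G : SimpleGraph V} {G' : SimpleGraph V'}
    {H : SimpleGraph W} {η : V' → Set W} (hη : IsHomCell G' H η) (f : G →g G') :
    IsHomCell G H (fun v => η (f v)) :=
  ⟨fun v => hη.1 (f v), fun u v h => hη.2 (f u) (f v) (f.map_adj h)⟩

/-- The continuous map `Hom(G', H) → Hom(G, H)` induced by a graph homomorphism `f : G → G'`;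
it sends the cell `c_η` to the cell `c_{η ∘ f}`, the coordinate at a vertex `v` of `G` being the
coordinate at `f v`. -/
def homComplexMap {V V' W : Type*} [Fintype W] {G : SimpleGraph V} {G' : SimpleGraph V'}
    (f : G →g G') (H : SimpleGraph W) : C(homComplex G' H, homComplex G H) where
  toFun x := ⟨fun v => x.1 (f v), by
    obtain ⟨η, hη, hx⟩ := x.2
    exact ⟨fun v => η (f v), hη.comp_hom f, fun v => hx (f v)⟩⟩
  continuous_toFun := by
    refine Continuous.subtype_mk (continuous_pi fun v => ?_) _
    exact (continuous_apply (f v)).comp continuous_subtype_val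

/-!
Two graph homomorphisms `f, g : G → G'` such that `f u` is adjacent to `g v` whenever `u` is
adjacent to `v` induce homotopic maps `Hom(G', H) → Hom(G, H)`: for a point `x` of the cell indexed
by `η`, the segment from `(x (f v))_v` to `(x (g v))_v` stays in the cell indexed by
`v ↦ η (f v) ∪ η (g v)` (`homComplexMap_homotopic`).

For `G = K₂` this allows either end of an edge of `G'` to be replaced by another neighbour of the
other end. Along a closed walk `a₀, a₁, …, aₙ = a₀` with `n = 2r + 1` odd, this moves
`(a₀, a₁)` to `(a₂, a₁)`, then to `(a₂, a₃)`, and so on: at each step the end with the smaller index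
jumps over the other one. Since `n` is odd, the edge comes back with its ends exchanged, as
`(aₙ₊₁, aₙ) = (a₁, a₀)` (`edgeHom_homotopic_swap`). The theorem is the case of the walk once around
the cycle, starting along the given edge.
-/

open SimpleGraph

theorem simplexOn_lineMap_mem {W : Type*} [Fintype W] {S T : Set W} {p q : W → ℝ}
    (hp : p ∈ simplexOn S) (hq : q ∈ simplexOn T) {t : ℝ} (h0 : 0 ≤ t) (h1 : t ≤ 1) :
    (1 - t) • p + t • q ∈ simplexOn (S ∪ T) := by
  refine ⟨convex_stdSimplex ℝ W hp.1 hq.1 (by linarith) h0 (by ring), fun w hw => ?_⟩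
  by_contra hmem
  have hpw : p w = 0 := by
    by_contra h
    exact hmem (Or.inl (hp.2 w h))
  have hqw : q w = 0 := by
    by_contra h
    exact hmem (Or.inr (hq.2 w h))
  exact hw (by simp [hpw, hqw])

theorem IsHomCell.union_comp {V V' W : Type*} {G : SimpleGraph V} {G' : SimpleGraph V'}
    {H : SimpleGraph W} {η : V' → Set W} (hη : IsHomCell G' H η) (f g : G →g G')
    (hfg : ∀ u v, G.Adj u v → G'.Adj (f u) (g v)) :
    IsHomCell G H (fun v => η (f v) ∪ η (g v)) := by
  refine ⟨fun v => (hη.1 (f v)).inl, fun u v huv a ha b hb => ?_⟩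
  rcases ha with ha | ha <;> rcases hb with hb | hb
  · exact hη.2 _ _ (f.map_adj huv) a ha b hb
  · exact hη.2 _ _ (hfg u v huv) a ha b hb
  · exact hη.2 _ _ (hfg v u huv.symm).symm a ha b hb
  · exact hη.2 _ _ (g.map_adj huv) a ha b hb

/-- Homomorphisms which are adjacent to each other in the sense of the hypothesis `hfg` induce
homotopic maps: the straight line between them never leaves the complex. -/
theorem homComplexMap_homotopic {V V' W : Type*} [Fintype W] {G : SimpleGraph V}
    {G' : SimpleGraph V'} (H : SimpleGraph W) (f g : G →g G')
    (hfg : ∀ u v, G.Adj u v → G'.Adj (f u) (g v)) :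
    ContinuousMap.Homotopic (homComplexMap f H) (homComplexMap g H) := by
  refine ⟨⟨⟨fun z => ⟨fun v => (1 - (z.1 : ℝ)) • z.2.1 (f v) + (z.1 : ℝ) • z.2.1 (g v), ?_⟩, ?_⟩,
    fun x => ?_, fun x => ?_⟩⟩
  · obtain ⟨η, hη, hx⟩ := z.2.2
    exact ⟨_, hη.union_comp f g hfg,
      fun v => simplexOn_lineMap_mem (hx (f v)) (hx (g v)) z.1.2.1 z.1.2.2⟩
  · refine Continuous.subtype_mk (continuous_pi fun v => ?_) _
    have hz (v' : V') : Continuous fun z : unitInterval × homComplex G' H => z.2.1 v' :=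
      (continuous_apply v').comp (continuous_subtype_val.comp continuous_snd)
    have ht : Continuous fun z : unitInterval × homComplex G' H => (z.1 : ℝ) :=
      continuous_subtype_val.comp continuous_fst
    exact ((continuous_const.sub ht).smul (hz _)).add (ht.smul (hz _))
  · exact Subtype.ext (by simp [homComplexMap])
  · exact Subtype.ext (by simp [homComplexMap])

/-- The homomorphism from `K₂` to `G` that sends the vertices `0` and `1` to the adjacent vertices
`u` and `v`. -/
def edgeHom {V : Type*} {G : SimpleGraph V} {u v : V} (h : G.Adj u v) :
    completeGraph (Fin 2) →g G where
  toFun := ![u, v]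
  map_rel' {a b} hab := by
    fin_cases a <;> fin_cases b <;> simp_all [G.adj_comm]

theorem edgeHom_homotopic {V W : Type*} [Fintype W] {G : SimpleGraph V} (H : SimpleGraph W)
    {u v u' v' : V} (h : G.Adj u v) (h' : G.Adj u' v') (h₁ : G.Adj u v') (h₂ : G.Adj u' v) :
    ContinuousMap.Homotopic (homComplexMap (edgeHom h) H) (homComplexMap (edgeHom h') H) := by
  refine homComplexMap_homotopic H _ _ fun a b hab => ?_
  fin_cases a <;> fin_cases b <;> simp_all [edgeHom, G.adj_comm]

theorem edgeHom_homotopic_even {V W : Type*} [Fintype W] {G : SimpleGraph V} (H : SimpleGraph W)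
    (a : ℕ → V) (ha : ∀ i, G.Adj (a i) (a (i + 1))) (j : ℕ) :
    ContinuousMap.Homotopic (homComplexMap (edgeHom (ha 0)) H)
      (homComplexMap (edgeHom (ha (2 * j))) H) := by
  induction j with
  | zero => exact ContinuousMap.Homotopic.refl _
  | succ j ih =>
    have e₁ := edgeHom_homotopic H (ha (2 * j)) (ha (2 * j + 1)).symm (ha _) (ha _).symm
    have e₂ := edgeHom_homotopic H (ha (2 * j + 1)).symm (ha (2 * j + 2)) (ha _) (ha _).symm
    exact (ih.trans e₁).trans e₂

/-- Transporting an edge along a closed walk of odd length exchanges its ends. -/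
theorem edgeHom_homotopic_swap {V W : Type*} [Fintype W] {G : SimpleGraph V} (H : SimpleGraph W)
    (a : ℕ → V) (ha : ∀ i, G.Adj (a i) (a (i + 1))) (r : ℕ) (h₀ : a (2 * r + 1) = a 0)
    (h₁ : a (2 * r + 2) = a 1) :
    ContinuousMap.Homotopic (homComplexMap (edgeHom (ha 0)) H)
      (homComplexMap (edgeHom (ha 0).symm) H) := by
  refine (edgeHom_homotopic_even H a ha r).trans (edgeHom_homotopic H _ _ ?_ ?_)
  · exact h₀ ▸ ha (2 * r)
  · exact h₁ ▸ (ha (2 * r + 1)).symm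

theorem theorem4p1 {W : Type*} [Fintype W] (H : SimpleGraph W) (r : ℕ) (hr : 1 ≤ r)
    (α : SimpleGraph.completeGraph (Fin 2) ↪g SimpleGraph.cycleGraph (2 * r + 1))
    (β : SimpleGraph.completeGraph (Fin 2) ≃g SimpleGraph.completeGraph (Fin 2)) (hβ : β ≠ SimpleGraph.Iso.refl) :
    ContinuousMap.Homotopic (homComplexMap α.toHom H)
      ((homComplexMap β.toHom H).comp (homComplexMap α.toHom H)) := by
  have hβ01 : β 0 = 1 ∧ β 1 = 0 := by
    have hne : β 0 ≠ β 1 := fun h => zero_ne_one (β.injective h)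
    by_contra hcon
    refine hβ (RelIso.ext fun i => ?_)
    have h0 : β 0 = 0 ∧ β 1 = 1 := by omega
    fin_cases i
    · exact h0.1
    · exact h0.2
  have hα : (cycleGraph (2 * r + 1)).Adj (α 0) (α 1) := α.map_adj_iff.2 (by simp)
  -- The walk around the cycle in the direction `α 1 - α 0`, which is `1` or `-1`.
  let a : ℕ → Fin (2 * r + 1) := fun i => α 0 + i • (α 1 - α 0)
  have ha1 : a 1 = α 1 := by simp [a]
  have ha : ∀ i, (cycleGraph (2 * r + 1)).Adj (a i) (a (i + 1)) := by
    obtain ⟨s, rfl⟩ := Nat.exists_eq_add_of_le' hr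
    intro i
    have h := (cycleGraph_adj (n := 2 * s + 1)).1 hα
    refine (cycleGraph_adj (n := 2 * s + 1)).2 ?_
    have e₁ : a (i + 1) - a i = α 1 - α 0 := by simp only [a, succ_nsmul]; abel
    have e₂ : a i - a (i + 1) = α 0 - α 1 := by simp only [a, succ_nsmul]; abel
    rcases h with h | h
    · exact Or.inl (e₂.trans h)
    · exact Or.inr (e₁.trans h)
  have hn : (2 * r + 1) • (α 1 - α 0) = 0 := by
    simpa using card_nsmul_eq_zero' (x := α 1 - α 0)
  have h₀ : a (2 * r + 1) = a 0 := by simp only [a, hn, zero_nsmul]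
  have h₁ : a (2 * r + 2) = a 1 := by
    simp only [a, succ_nsmul _ (2 * r + 1), hn, one_nsmul, zero_add]
  convert edgeHom_homotopic_swap H a ha r h₀ h₁ using 1
  · congr 1
    ext i
    fin_cases i <;> simp [edgeHom, a]
  · change homComplexMap (α.toHom.comp β.toHom) H = _
    congr 1
    ext i
    fin_cases i <;> simp [edgeHom, a, hβ01]
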